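/- Theorem 1.4. Let $M$ be a manifold, possibly with boundary, i.e. a connected Hausdorff space each of whose points has a neighborhood homeomorphic to $\mathbb{R}^{n-1}\times\mathbb{R}_{\ge 0}$ for some finite $n>0$; $M$ is not assumed to be metrizable. (1) If $M$ contains a copy (that is, a homeomorphic image) of an uncountable $\omega_1$-compact subset $S$ of an $\omega_1$-tree $T$, where $S$ carries the subspace topology, then $M$ is not homotopy equivalent to a CW-complex. (2) In particular, if $M$ contains a copy of a Suslin tree, then $M$ is not homotopy equivalent to a CW-complex. Here a tree is a partially ordered set $T$ in which the set of predecessors $\{y\,:\,y<x\}$ of each point $x$ is well ordered; the height of $x$ is the order type of this set, the $\alpha$-th level is the set of points of height $\alpha$, and the height of $T$ is the least ordinal $\alpha$ such that the $\alpha$-th level is empty. Trees carry the interval topology, whose base consists of the intervals $(x,y]$ and the singletons of minimal points, and are assumed Hausdorff: two points at the same limit level (of nonzero limit height) with the same predecessors are equal. An $\omega_1$-tree is a tree of height $\omega_1$ with countable levels. A Suslin tree is a tree of height $\omega_1$ whose chains and antichains are all at most countable. A space is $\omega_1$-compact if each of its closed discrete subsets is at most countable. -/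

import Mathlib

open Set Topology

universe u v w

/-- A set-theoretic tree: a partially ordered set in which the set of predecessors of each point
is well ordered. -/
class OrderTree (T : Type u) [PartialOrder T] : Prop where
  wellOrder_Iio : ∀ x : T, IsWellOrder (Iio x) (· < ·)

namespace OrderTree

attribute [instance] OrderTree.wellOrder_Iio

/-- The height of a point of a tree: the order type of its set of predecessors. -/
noncomputable def height {T : Type u} [PartialOrder T] [OrderTree T] (x : T) : Ordinal.{u} :=
  Ordinal.type (fun a b : Iio x => a < b)

/-- The `α`-th level of a tree: the set of points of height `α`. -/
def level (T : Type u) [PartialOrder T] [OrderTree T] (α : Ordinal.{u}) : Set T :=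
  {x | height x = α}

/-- The height of a tree: the supremum of `height x + 1` over its points `x`. -/
noncomputable def treeHeight (T : Type u) [PartialOrder T] [OrderTree T] : Ordinal.{u} :=
  ⨆ x : T, Order.succ (height x)

/-- Points at the same limit level having the same predecessors are equal. There may be several
minimal elements (`Order.IsSuccLimit` excludes `0`). -/
def IsHausdorff (T : Type u) [PartialOrder T] [OrderTree T] : Prop :=
  ∀ x y : T, Order.IsSuccLimit (height x) → Iio x = Iio y → x = y

/-- A (Hausdorff) `ω₁`-tree: a tree of height `ω₁` with countable levels. -/
structure IsOmega1Tree (T : Type u) [PartialOrder T] [OrderTree T] : Prop where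
  hausdorff : IsHausdorff T
  height_eq : treeHeight T = Ordinal.omega 1
  countable_level : ∀ α : Ordinal.{u}, (level T α).Countable

/-- A (Hausdorff) Suslin tree: a tree of height `ω₁` whose chains and antichains are
at most countable. -/
structure IsSuslin (T : Type u) [PartialOrder T] [OrderTree T] : Prop where
  hausdorff : IsHausdorff T
  height_eq : treeHeight T = Ordinal.omega 1
  countable_chain : ∀ C : Set T, IsChain (· ≤ ·) C → C.Countable
  countable_antichain : ∀ A : Set T, IsAntichain (· ≤ ·) A → A.Countable

/-- The topology of `T` is the interval topology of the tree `T`: it is generated by the intervals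
`(x, y]` and the singletons of minimal points. (`OrderTopology` would be
a different topology: its open rays `Iio y` do not separate two maximal points of `T` having
the same predecessors.) -/
class IntervalTopology (T : Type u) [PartialOrder T] [t : TopologicalSpace T] : Prop where
  topology_eq : t = TopologicalSpace.generateFrom
    ({U | ∃ x y : T, U = Ioc x y} ∪ {U | ∃ x : T, IsMin x ∧ U = {x}})

end OrderTree

/-- A space is `ω₁`-compact (has countable extent) if its closed discrete subsets are
at most countable. -/
def Omega1Compact (X : Type u) [TopologicalSpace X] : Prop :=
  ∀ A : Set X, IsClosed A → DiscreteTopology A → A.Countable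

/-- A manifold with (possibly empty) boundary: a connected Hausdorff space in which each point has
a (not necessarily open) neighborhood homeomorphic to `ℝ^n × [0, ∞)` for some `n`. Every connected
Hausdorff space locally homeomorphic to `ℝ^(n+1)` is of this kind. -/
structure IsManifoldWithBoundary (M : Type u) [TopologicalSpace M] : Prop where
  t2 : T2Space M
  connected : ConnectedSpace M
  locally_halfSpace : ∀ x : M, ∃ n : ℕ, ∃ U ∈ 𝓝 x,
    Nonempty (U ≃ₜ EuclideanSpace ℝ (Fin n) × Ici (0 : ℝ))

/-- `M` is homotopy equivalent to a CW-complex. -/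
def IsHeCWc (M : Type u) [TopologicalSpace M] : Prop :=
  ∃ (W : Type v) (_ : TopologicalSpace W) (_ : T2Space W),
    Nonempty (Topology.CWComplex (univ : Set W)) ∧ Nonempty (ContinuousMap.HomotopyEquiv M W)

/-! By `ω₁`-compactness, antichains in the downward closure of `S` are countable, so all but
countably many points of `S` lie in `stem S`. Call `S ∩ Ioi y` with `y ∈ stem S` a cone; cones are
uncountable. Cones behave like tails of `ω₁`: if countably many closed sets have no common point in
a cone, one of them misses a smaller cone (`IsOmega1Tree.exists_cone_disjoint`). Hence a continuous
map whose values on a cone have a countable closed network is constant on a smaller cone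
(`IsOmega1Tree.exists_cone_const`).

The image of `S` in a CW-complex meets countably many cells, so it has such a network, and the
composite `S → M → W → M` is constant on a cone. A homotopy joins this composite to the embedding.
The times at which it is constant on a sufficiently high cone form a set that is closed, and open
because `M` locally has countable closed networks (`IsOmega1Tree.exists_cone_const_of_homotopy`).
Connectedness of the interval makes the embedding constant on an uncountable set, contradicting
injectivity. -/

open Ordinal in
theorem Ordinal.countable_Iio_of_lt_omega_one {α : Ordinal.{u}} (h : α < ω₁) :
    (Iio α).Countable := by
  rw [← Cardinal.le_aleph0_iff_set_countable, Cardinal.mk_Iio_ordinal,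
    ← Cardinal.lift_aleph0.{u + 1, u}, Cardinal.lift_le, ← Order.lt_succ_iff, Cardinal.succ_aleph0]
  exact Cardinal.lt_omega_iff_card_lt.1 h

theorem Omega1Compact.countable_of_forall_not_accPt {X : Type u} [TopologicalSpace X]
    (h : Omega1Compact X) {A : Set X} (hA : ∀ x, ¬ AccPt x (Filter.principal A)) :
    A.Countable :=
  h A (isClosed_iff_accPt.2 fun x hx => (hA x hx).elim)
    (discreteTopology_of_noAccPts fun x _ => hA x)

/-! ### Order and interval topology of trees -/

namespace OrderTree

variable {T : Type u} [PartialOrder T]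

theorem isAntichain_minimal (D : Set T) : IsAntichain (· ≤ ·) {m | Minimal (· ∈ D) m} :=
  fun _ ha _ hb hne h => hne (le_antisymm h (hb.2 ha.1 h))

section

variable [TopologicalSpace T] [IntervalTopology T]

theorem isOpen_Ioc (x y : T) : IsOpen (Ioc x y) := by
  rw [IntervalTopology.topology_eq (T := T)]
  exact .basic _ (Or.inl ⟨x, y, rfl⟩)

theorem isOpen_singleton_of_isMin {x : T} (hx : IsMin x) : IsOpen {x} := by
  rw [IntervalTopology.topology_eq (T := T)]
  exact .basic _ (Or.inr ⟨x, hx, rfl⟩)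

theorem exists_lt_lt_of_accPt {S : Set T} {A : Set S} {s : S}
    (h : AccPt s (Filter.principal A)) :
    (∃ w : T, w < s) ∧ ∀ w < (s : T), ∃ a ∈ A, w < (a : T) ∧ (a : T) < s := by
  rw [accPt_iff_nhds] at h
  refine ⟨?_, fun w hw => ?_⟩
  · by_contra hmin
    have hmin : IsMin (s : T) := fun b hb => by
      by_contra hne
      exact hmin ⟨b, lt_of_le_not_ge hb hne⟩
    obtain ⟨a, ⟨ha, -⟩, hne⟩ := h (Subtype.val ⁻¹' {(s : T)})
      (((isOpen_singleton_of_isMin hmin).preimage continuous_subtype_val).mem_nhds rfl)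
    exact hne (Subtype.ext ha)
  · obtain ⟨a, ⟨ha, haA⟩, hne⟩ := h (Subtype.val ⁻¹' Ioc w (s : T))
      (((isOpen_Ioc w _).preimage continuous_subtype_val).mem_nhds ⟨hw, le_rfl⟩)
    exact ⟨a, haA, ha.1, lt_of_le_of_ne ha.2 (Subtype.coe_ne_coe.2 hne)⟩

end

/-- The points of the tree having uncountably many successors in `S`. -/
def stem (S : Set T) : Set T := {y | ¬ (S ∩ Ioi y).Countable}

theorem exists_gt_of_mem_stem {S : Set T} {y : T} (hy : y ∈ stem S) : ∃ s ∈ S, y < s := by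
  by_contra! h
  refine hy ?_
  convert countable_empty
  exact eq_empty_of_forall_notMem fun s hs => h s hs.1 hs.2

variable [OrderTree T]

section Order

theorem lt_trichotomy_of_lt {a b x : T} (ha : a < x) (hb : b < x) : a < b ∨ a = b ∨ b < a := by
  rcases trichotomous_of (α := Iio x) (· < ·) ⟨a, ha⟩ ⟨b, hb⟩ with h | h | h
  · exact Or.inl h
  · exact Or.inr (Or.inl (congrArg Subtype.val h))
  · exact Or.inr (Or.inr h)

theorem lt_or_le_of_le {a b x : T} (ha : a ≤ x) (hb : b ≤ x) : a < b ∨ b ≤ a := by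
  rcases ha.lt_or_eq with ha | rfl
  · rcases hb.lt_or_eq with hb | rfl
    · rcases lt_trichotomy_of_lt ha hb with h | h | h
      · exact Or.inl h
      · exact Or.inr h.ge
      · exact Or.inr h.le
    · exact Or.inl ha
  · exact Or.inr hb

theorem height_strictMono : StrictMono (height : T → Ordinal.{u}) := by
  intro x y hxy
  refine Ordinal.type_lt_iff.2 ⟨⟨⟨⟨fun a => ⟨a.1, a.2.trans hxy⟩, ?_⟩, Iff.rfl⟩, ⟨x, hxy⟩, ?_⟩⟩
  · intro a b h
    exact Subtype.ext (congrArg (fun z : Iio y => z.1) h)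
  · intro b
    constructor
    · rintro ⟨a, rfl⟩
      exact a.2
    · intro h
      exact ⟨⟨b.1, h⟩, rfl⟩

theorem exists_minimal_le {D : Set T} {z : T} (hz : z ∈ D) :
    ∃ m ≤ z, Minimal (· ∈ D) m := by
  obtain ⟨m, ⟨hmz, hm⟩, hmin⟩ := (InvImage.wf (height : T → Ordinal.{u})
    wellFounded_lt).has_min {m | m ≤ z ∧ m ∈ D} ⟨z, le_rfl, hz⟩
  refine ⟨m, hmz, hm, fun y hy hym => ?_⟩
  by_contra hne
  exact hmin y ⟨hym.trans hmz, hy⟩ (height_strictMono (lt_of_le_not_ge hym hne))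

open Ordinal in
theorem height_lt_omega_one (hT : treeHeight T = ω₁) (x : T) : height x < ω₁ := by
  rw [← hT]
  exact (Order.lt_succ _).trans_le (Ordinal.le_iSup (fun x : T => Order.succ (height x)) x)

open Ordinal in
theorem exists_height_lt (hT : treeHeight T = ω₁) {A : Set T} (hA : A.Countable) :
    ∃ α < (ω₁ : Ordinal.{u}), ∀ a ∈ A, height a < α := by
  have := hA.to_subtype
  refine ⟨⨆ a : A, Order.succ (height a.1), Ordinal.iSup_lt_omega_one fun a => ?_, fun a ha => ?_⟩
  · exact (Cardinal.isSuccLimit_omega 1).succ_lt (height_lt_omega_one hT a.1)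
  · exact (Order.lt_succ _).trans_le
      (Ordinal.le_iSup (fun a : A => Order.succ (height a.1)) ⟨a, ha⟩)

open Ordinal in
theorem IsOmega1Tree.countable_height_lt (hT : IsOmega1Tree T) {α : Ordinal.{u}} (hα : α < ω₁) :
    {x : T | height x < α}.Countable := by
  have : {x : T | height x < α} = ⋃ β ∈ Iio α, level T β := by
    ext x
    simp [level]
  rw [this]
  exact (Ordinal.countable_Iio_of_lt_omega_one hα).biUnion fun β _ => hT.countable_level β

theorem countable_Iic_of_height (hT : IsOmega1Tree T) (x : T) : (Iic x).Countable := by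
  refine (hT.countable_height_lt ((Cardinal.isSuccLimit_omega 1).succ_lt
    (height_lt_omega_one hT.height_eq x))).mono fun y hy => ?_
  exact Order.lt_succ_iff.2 (height_strictMono.monotone hy)

end Order

section Topology

variable [TopologicalSpace T] [IntervalTopology T]

theorem exists_Ioc_subset {U : Set T} (hU : IsOpen U) {z : T} (hz : z ∈ U) (hmin : ¬ IsMin z) :
    ∃ w < z, Ioc w z ⊆ U := by
  rw [IntervalTopology.topology_eq (T := T)] at hU
  induction hU with
  | basic s hs =>
    rcases hs with ⟨x, y, rfl⟩ | ⟨x, hx, rfl⟩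
    · exact ⟨x, hz.1, Ioc_subset_Ioc_right hz.2⟩
    · exact (hmin (hz ▸ hx)).elim
  | univ =>
    obtain ⟨w, hw⟩ := not_isMin_iff.1 hmin
    exact ⟨w, hw, subset_univ _⟩
  | inter s t _ _ ihs iht =>
    obtain ⟨a, ha, has⟩ := ihs hz.1
    obtain ⟨b, hb, hbt⟩ := iht hz.2
    -- Both left endpoints lie below `z`, hence are comparable; the larger one serves.
    rcases lt_or_le_of_le ha.le hb.le with h | h
    · exact ⟨b, hb, fun y hy => ⟨has ⟨h.trans hy.1, hy.2⟩, hbt hy⟩⟩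
    · exact ⟨a, ha, fun y hy => ⟨has hy, hbt ⟨h.trans_lt hy.1, hy.2⟩⟩⟩
  | sUnion 𝒮 _ ih =>
    obtain ⟨s, hs, hzs⟩ := hz
    obtain ⟨w, hw, h⟩ := ih s hs hzs
    exact ⟨w, hw, h.trans (subset_sUnion_of_mem hs)⟩

theorem mem_of_isClosed_of_forall_lt {S : Set T} {C : Set S} (hC : IsClosed C) {s : S}
    (hmin : ∃ w : T, w < s) (h : ∀ w < (s : T), ∃ c ∈ C, w < (c : T) ∧ (c : T) < s) : s ∈ C := by
  rw [← hC.closure_eq, mem_closure_iff]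
  rintro U ⟨V, hV, rfl⟩ hs
  obtain ⟨w, hw, hwV⟩ := exists_Ioc_subset hV hs (not_isMin_iff.2 hmin)
  obtain ⟨c, hc, hwc, hcs⟩ := h w hw
  exact ⟨c, hwV ⟨hwc, hcs.le⟩, hc⟩

end Topology

/-- `S` satisfies the countable chain condition: each antichain in its downward closure is
countable. -/
def HasCountableAntichains (S : Set T) : Prop :=
  ∀ A : Set T, IsAntichain (· ≤ ·) A → (∀ a ∈ A, ∃ s ∈ S, a ≤ s) → A.Countable

/-- Choose a point of `S` above each member of the antichain. Two chosen points below a common `s`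
would come from comparable, hence equal, members, so the chosen points cannot accumulate. -/
theorem hasCountableAntichains_of_omega1Compact [TopologicalSpace T] [IntervalTopology T]
    {S : Set T} (hS : Omega1Compact S) : HasCountableAntichains S := by
  intro A hA hAS
  choose! f hfS hf using hAS
  have hinj : InjOn f A := by
    intro a ha b hb hab
    rcases lt_or_le_of_le (hf a ha) (hab ▸ hf b hb) with h | h
    · exact hA.eq ha hb h.le
    · exact (hA.eq hb ha h).symm
  have hcount : {s : S | (s : T) ∈ f '' A}.Countable := by
    refine hS.countable_of_forall_not_accPt fun s hs => ?_
    obtain ⟨⟨w, hw⟩, h⟩ := exists_lt_lt_of_accPt hs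
    obtain ⟨b, ⟨a, ha, hab⟩, -, hbs⟩ := h w hw
    obtain ⟨b', ⟨a', ha', hab'⟩, hbb', hbs'⟩ := h b hbs
    have h1 : a ≤ s := ((hf a ha).trans_eq hab).trans hbs.le
    have h2 : a' ≤ s := ((hf a' ha').trans_eq hab').trans hbs'.le
    have : a = a' := by
      rcases lt_or_le_of_le h1 h2 with h | h
      · exact hA.eq ha ha' h.le
      · exact (hA.eq ha' ha h).symm
    subst this
    exact hbb'.ne (hab.symm.trans hab')
  refine countable_of_injective_of_countable_image hinj ((hcount.image Subtype.val).mono ?_)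
  rintro _ ⟨a, ha, rfl⟩
  exact ⟨⟨f a, hfS a ha⟩, ⟨a, ha, rfl⟩, rfl⟩

/-! ### Stabilization and closed sets in cones -/

open Ordinal

/-- The minimal points off the stem form a countable antichain, and each has only countably many
points of `S` above it. -/
theorem HasCountableAntichains.countable_diff_stem {S : Set T} (hS : HasCountableAntichains S) :
    (S \ stem S).Countable := by
  set B : Set T := {y | y ∉ stem S ∧ ∃ s ∈ S, y ≤ s}
  have hB : {m | Minimal (· ∈ B) m}.Countable :=
    hS _ (isAntichain_minimal B) fun a ha => ha.1.2
  refine (hB.biUnion (t := fun m _ => {m} ∪ (S ∩ Ioi m)) fun m hm => ?_).mono fun s hs => ?_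
  · exact (countable_singleton m).union (not_not.1 hm.1.1)
  · obtain ⟨m, hms, hm⟩ := exists_minimal_le (D := B) (z := s) ⟨hs.2, s, hs.1, le_rfl⟩
    simp only [mem_iUnion]
    refine ⟨m, hm, ?_⟩
    rcases hms.eq_or_lt with rfl | h
    · exact Or.inl rfl
    · exact Or.inr ⟨hs.1, h⟩

/-- The minimal elements of each `D i ∩ stem S` form a countable antichain; `α` exceeds the heights
of all of them. -/
theorem HasCountableAntichains.exists_height_decides {S : Set T} (hS : HasCountableAntichains S)
    (hT : treeHeight T = ω₁) {ι : Type*} [Countable ι] {D : ι → Set T}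
    (hD : ∀ i, ∀ y ∈ D i, ∀ z ∈ stem S, y ≤ z → z ∈ D i) :
    ∃ α < (ω₁ : Ordinal.{u}), ∀ i, ∀ y ∈ stem S, α ≤ height y →
      ∀ z ∈ stem S, y ≤ z → z ∈ D i → y ∈ D i := by
  have hcount : (⋃ i, {m | Minimal (· ∈ D i ∩ stem S) m}).Countable :=
    countable_iUnion fun i => hS _ (isAntichain_minimal _) fun a ha => by
      obtain ⟨s, hs, has⟩ := exists_gt_of_mem_stem ha.1.2
      exact ⟨s, hs, has.le⟩
  obtain ⟨α, hα, h⟩ := exists_height_lt hT hcount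
  refine ⟨α, hα, fun i y hy hαy z hz hyz hzD => ?_⟩
  obtain ⟨m, hmz, hm⟩ := exists_minimal_le (D := D i ∩ stem S) ⟨hzD, hz⟩
  refine hD i m hm.1.1 y hy ?_
  rcases lt_or_le_of_le hmz hyz with h' | h'
  · exact h'.le
  · exact absurd (height_strictMono.monotone h')
      (not_le.2 ((h m (mem_iUnion.2 ⟨i, hm⟩)).trans_le hαy))

theorem IsOmega1Tree.exists_gt_of_mem_stem (hT : IsOmega1Tree T) {S : Set T}
    (hS : HasCountableAntichains S) {y : T} (hy : y ∈ stem S) {α : Ordinal.{u}} (hα : α < ω₁) :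
    ∃ s ∈ S, s ∈ stem S ∧ y < s ∧ α ≤ height s := by
  by_contra! h
  refine hy ((hS.countable_diff_stem.union (hT.countable_height_lt hα)).mono ?_)
  rintro s ⟨hs, hys⟩
  by_cases hst : s ∈ stem S
  · exact Or.inr (h s hs hst hys)
  · exact Or.inl ⟨hs, hst⟩

variable [TopologicalSpace T] [IntervalTopology T]

/-- A substitute for closing off under `g` along `ω₁`. If no such `s` exists, a maximal
`g`-separated set `A` above `x` has no accumulation point, so it is countable; then a sufficiently
high point can still be added to it. -/
theorem IsOmega1Tree.exists_height_closed (hT : IsOmega1Tree T) {S : Set T}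
    (hS : Omega1Compact S) {x : T} (hx : x ∈ stem S) {g : T → Ordinal.{u}}
    (hg : ∀ w, g w < ω₁) : ∃ s ∈ S, x < s ∧ ∀ w < s, g w ≤ height s := by
  by_contra! hcon
  have hS' := hasCountableAntichains_of_omega1Compact hS
  let R : S → S → Prop := fun a b => ∀ w ≤ (a : T), g w ≤ height (b : T)
  let 𝒜 : Set (Set S) := {A | (∀ a ∈ A, x < a) ∧ A.Pairwise fun a b => R a b ∨ R b a}
  obtain ⟨A, hA⟩ : ∃ A, Maximal (· ∈ 𝒜) A := zorn_subset 𝒜 fun c hc hchain =>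
    ⟨⋃₀ c, ⟨fun a ⟨B, hB, ha⟩ => (hc hB).1 a ha,
      (pairwise_sUnion hchain.directedOn).2 fun B hB => (hc hB).2⟩,
      fun s hs => subset_sUnion_of_mem hs⟩
  have hcount : A.Countable := by
    refine hS.countable_of_forall_not_accPt fun s hs => ?_
    obtain ⟨⟨w, hw⟩, h⟩ := exists_lt_lt_of_accPt hs
    obtain ⟨a, ha, -, has⟩ := h w hw
    obtain ⟨w, hws, hgw⟩ := hcon s s.2 ((hA.1.1 a ha).trans has)
    obtain ⟨a, ha, hwa, has⟩ := h w hws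
    obtain ⟨b, hb, hab, hbs⟩ := h a has
    refine absurd hgw (not_lt.2 ?_)
    -- With `w < a < b < s`, separation of `a` and `b` in either order bounds `g w` by a height
    -- below that of `s`.
    rcases hA.1.2 ha hb (fun h => hab.ne (congrArg Subtype.val h)) with h' | h'
    · exact (h' w hwa.le).trans (height_strictMono hbs).le
    · exact (h' w (hwa.trans hab).le).trans (height_strictMono has).le
  have hcount' : (⋃ a ∈ A, Iic (a : T)).Countable :=
    hcount.biUnion fun a _ => countable_Iic_of_height hT a.1
  have := hcount'.to_subtype
  obtain ⟨α, hα, hαA⟩ := exists_height_lt hT.height_eq hcount'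
  obtain ⟨s, hs, -, hxs, hsα⟩ := hT.exists_gt_of_mem_stem hS' hx
    (max_lt hα (Ordinal.iSup_lt_omega_one (f := fun w : (⋃ a ∈ A, Iic (a : T)) => g w)
      fun w => hg w))
  have hmem : (⟨s, hs⟩ : S) ∈ A := by
    refine hA.2 (y := insert ⟨s, hs⟩ A) ⟨?_, ?_⟩ (subset_insert _ _) (mem_insert _ _)
    · rintro a (rfl | ha)
      · exact hxs
      · exact hA.1.1 a ha
    · refine pairwise_insert.2 ⟨hA.1.2, fun a ha _ => ?_⟩
      suffices h : R a ⟨s, hs⟩ from ⟨Or.inr h, Or.inl h⟩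
      intro w hw
      exact (Ordinal.le_iSup (fun w : (⋃ a ∈ A, Iic (a : T)) => g w)
        ⟨w, mem_biUnion ha hw⟩).trans ((le_max_right _ _).trans hsα)
  exact absurd (hαA s (mem_biUnion hmem le_rfl)) (not_lt.2 ((le_max_left _ _).trans hsα))

/-- Otherwise every `C i` meets every cone above `x`. Stabilization reflects points of `C i` above
`s` to points below `s`, beyond any given `w < s`, once `s` is closed under the stabilization
heights. Such an `s` is a limit of every `C i`, hence a common point. -/
theorem IsOmega1Tree.exists_cone_disjoint (hT : IsOmega1Tree T) {S : Set T}
    (hS : Omega1Compact S) {x : T} (hx : x ∈ stem S) {ι : Type*} [Countable ι] {C : ι → Set S}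
    (hC : ∀ i, IsClosed (C i)) (hCx : ∀ s : S, x < s → ∃ i, s ∉ C i) :
    ∃ y ∈ stem S, x ≤ y ∧ ∃ i, ∀ s : S, y < s → s ∉ C i := by
  by_contra! hcon
  have hS' := hasCountableAntichains_of_omega1Compact hS
  obtain ⟨γ, hγ, hγS⟩ := exists_height_lt hT.height_eq hS'.countable_diff_stem
  have hstem : ∀ s ∈ S, γ ≤ height s → s ∈ stem S := fun s hs hsγ => by
    by_contra h
    exact absurd (hγS s ⟨hs, h⟩) (not_lt.2 hsγ)
  have hdec := fun w : T => hS'.exists_height_decides hT.height_eq (ι := ι)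
    (D := fun i => {y | ∃ c ∈ C i, (c : T) < y ∧ height w < height (c : T)}) ?_
  · choose g hg hgD using hdec
    obtain ⟨s, hs, hxs, hgs⟩ := hT.exists_height_closed hS hx
      (g := fun w => max γ (g w)) fun w => max_lt hγ (hg w)
    have hsstem : s ∈ stem S := hstem s hs ((le_max_left _ _).trans (hgs x hxs))
    obtain ⟨i, hi⟩ := hCx ⟨s, hs⟩ hxs
    refine hi (mem_of_isClosed_of_forall_lt (hC i) ⟨x, hxs⟩ fun w hw => ?_)
    obtain ⟨z, hzS, hz, hsz, hzγ⟩ := hT.exists_gt_of_mem_stem hS' hsstem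
      (max_lt hγ (height_lt_omega_one hT.height_eq w))
    obtain ⟨c, hzc, hc⟩ := hcon z hz (hxs.le.trans hsz.le) i
    have hcz := height_strictMono hzc
    have hcstem : (c : T) ∈ stem S :=
      hstem c c.2 ((le_max_left _ _).trans (hzγ.trans hcz.le))
    obtain ⟨z', hz'S, hz', hcz', -⟩ := hT.exists_gt_of_mem_stem hS' hcstem hγ
    obtain ⟨c', hc', hc's, hwc'⟩ := hgD w i s hsstem ((le_max_right _ _).trans (hgs w hw)) z' hz'
      ((hsz.trans hzc).trans hcz').le
      ⟨c, hc, hcz', (le_max_right _ _).trans_lt (hzγ.trans_lt hcz)⟩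
    refine ⟨c', hc', ?_, hc's⟩
    rcases lt_or_le_of_le hw.le hc's.le with h | h
    · exact h
    · exact absurd (height_strictMono.monotone h) (not_le.2 hwc')
  · rintro i y ⟨c, hc, hcy, hwc⟩ z - hyz
    exact ⟨c, hc, hcy.trans_le hyz, hwc⟩

end OrderTree

theorem Omega1Compact.univ {X : Type u} [TopologicalSpace X] (h : Omega1Compact X) :
    Omega1Compact (univ : Set X) := by
  intro A hA hAd
  let φ := Homeomorph.Set.univ X
  have : DiscreteTopology (φ '' A) := (φ.image A).symm.isEmbedding.discreteTopology
  exact countable_of_injective_of_countable_image φ.injective.injOn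
    (h (φ '' A) ((φ.isClosed_image).2 hA) this)

/-- A subset `Y` of a space has a countable closed network if there is a countable family of closed
sets such that each neighborhood of a point `p` of `Y` contains a member of the family
containing `p`. -/
def HasCountableClosedNetwork {X : Type u} [TopologicalSpace X] (Y : Set X) : Prop :=
  ∃ 𝓕 : Set (Set X), 𝓕.Countable ∧ (∀ F ∈ 𝓕, IsClosed F) ∧
    ∀ p ∈ Y, ∀ U ∈ 𝓝 p, ∃ F ∈ 𝓕, p ∈ F ∧ F ⊆ U

/-! ### Countable closed networks -/

namespace HasCountableClosedNetwork

variable {X : Type u} [TopologicalSpace X]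

theorem mono {Y Z : Set X} (hZ : HasCountableClosedNetwork Z) (h : Y ⊆ Z) :
    HasCountableClosedNetwork Y := by
  obtain ⟨𝓕, h𝓕, hcl, hnet⟩ := hZ
  exact ⟨𝓕, h𝓕, hcl, fun p hp => hnet p (h hp)⟩

theorem iUnion {ι : Type*} [Countable ι] {Y : ι → Set X}
    (hY : ∀ i, HasCountableClosedNetwork (Y i)) : HasCountableClosedNetwork (⋃ i, Y i) := by
  choose 𝓕 h𝓕 hcl hnet using hY
  refine ⟨⋃ i, 𝓕 i, countable_iUnion h𝓕, fun F hF => ?_, fun p hp U hU => ?_⟩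
  · obtain ⟨i, hi⟩ := mem_iUnion.1 hF
    exact hcl i F hi
  · obtain ⟨i, hi⟩ := mem_iUnion.1 hp
    obtain ⟨F, hF, h⟩ := hnet i p hi U hU
    exact ⟨F, mem_iUnion.2 ⟨i, hF⟩, h⟩

/-- Images of compact closures of basic open sets are compact, hence closed, and form the network.
-/
theorem range [T2Space X] {Z : Type*} [TopologicalSpace Z] [SecondCountableTopology Z] [T2Space Z]
    [LocallyCompactSpace Z] {f : Z → X} (hf : Continuous f) :
    HasCountableClosedNetwork (range f) := by
  have hB := TopologicalSpace.isBasis_countableBasis Z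
  refine ⟨(fun b => f '' closure b) ''
    {b | b ∈ TopologicalSpace.countableBasis Z ∧ IsCompact (closure b)},
    ((TopologicalSpace.countable_countableBasis Z).mono fun b hb => hb.1).image _, ?_, ?_⟩
  · rintro _ ⟨b, ⟨-, hb⟩, rfl⟩
    exact (hb.image hf).isClosed
  · rintro _ ⟨a, rfl⟩ U hU
    obtain ⟨K, hKa, hKU, hK⟩ := local_compact_nhds (hf.continuousAt.preimage_mem_nhds hU)
    obtain ⟨b, hb, hab, hbK⟩ := hB.exists_closure_subset hKa
    refine ⟨_, ⟨b, ⟨hb, hK.of_isClosed_subset isClosed_closure hbK⟩, rfl⟩,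
      ⟨a, subset_closure hab, rfl⟩, ?_⟩
    rintro _ ⟨z, hz, rfl⟩
    exact hKU (hbK hz)

end HasCountableClosedNetwork

theorem IsManifoldWithBoundary.exists_nhds_hasCountableClosedNetwork {M : Type u}
    [TopologicalSpace M] (hM : IsManifoldWithBoundary M) (x : M) :
    ∃ U ∈ 𝓝 x, HasCountableClosedNetwork U := by
  have := hM.t2
  obtain ⟨n, U, hU, ⟨e⟩⟩ := hM.locally_halfSpace x
  have : LocallyCompactSpace (Ici (0 : ℝ)) :=
    isClosed_Ici.isClosedEmbedding_subtypeVal.locallyCompactSpace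
  refine ⟨U, hU, ?_⟩
  have h := HasCountableClosedNetwork.range (continuous_subtype_val.comp e.symm.continuous)
  rwa [e.symm.surjective.range_comp, Subtype.range_coe] at h

/-! ### Images of `ω₁`-compact spaces in CW-complexes -/

namespace Topology.CWComplex

variable {W : Type u} [TopologicalSpace W]

theorem hasCountableClosedNetwork_closedCell [T2Space W] {C : Set W} [CWComplex C] (n : ℕ)
    (i : cell C n) : HasCountableClosedNetwork (closedCell n i) := by
  have : CompactSpace (Metric.closedBall (0 : Fin n → ℝ) 1) :=
    isCompact_iff_compactSpace.1 (isCompact_closedBall _ _)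
  have h := HasCountableClosedNetwork.range (continuousOn_iff_continuous_domRestrict.1
    (RelCWComplex.continuousOn n i))
  rwa [range_domRestrict] at h

/-- A set containing at most one point from each open cell meets each closed cell in a finite
set. -/
theorem finite_inter_closedCell {C : Set W} [CWComplex C] {A : Set W}
    (hA : ∀ n (i : cell C n), (A ∩ openCell n i).Subsingleton) (n : ℕ) (i : cell C n) :
    (A ∩ closedCell n i).Finite := by
  obtain ⟨I, hI⟩ := cellFrontier_subset_finite_openCell n i
  refine Finite.subset (s := (⋃ m ∈ Iio n, ⋃ j ∈ I m, A ∩ openCell m j) ∪ A ∩ openCell n i) ?_ ?_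
  · exact ((finite_Iio n).biUnion fun m _ => (I m).finite_toSet.biUnion fun j _ =>
      (hA m j).finite).union (hA n i).finite
  · rw [← cellFrontier_union_openCell_eq_closedCell]
    rintro a ⟨haA, ha | ha⟩
    · obtain ⟨m, hm, j, hj, haj⟩ := by simpa using hI ha
      left
      simp only [mem_iUnion]
      exact ⟨m, hm, j, hj, haA, haj⟩
    · exact Or.inr ⟨haA, ha⟩

theorem isClosed_of_subsingleton_inter_openCell [T2Space W] [CWComplex (univ : Set W)] {A : Set W}
    (hA : ∀ n (i : cell (univ : Set W) n), (A ∩ openCell n i).Subsingleton) : IsClosed A :=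
  (closed univ A (subset_univ _)).2 fun n i => (finite_inter_closedCell hA n i).isClosed

/-- A continuous image of an `ω₁`-compact space in a CW-complex meets only countably many open
cells. -/
theorem countable_openCell_of_omega1Compact [T2Space W] [CWComplex (univ : Set W)] {S : Type v}
    [TopologicalSpace S] [T1Space S] (hS : Omega1Compact S) {f : S → W} (hf : Continuous f) :
    {c : Σ n, cell (univ : Set W) n | ∃ s, f s ∈ openCell c.1 c.2}.Countable := by
  set 𝒞 := {c : Σ n, cell (univ : Set W) n | ∃ s, f s ∈ openCell c.1 c.2}
  rcases isEmpty_or_nonempty S with hempty | hne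
  · exact countable_empty.mono fun c ⟨s, _⟩ => hempty.elim s
  choose! σ hσ using fun (c : Σ n, cell (univ : Set W) n) (hc : c ∈ 𝒞) => hc
  have heq : ∀ c ∈ 𝒞, ∀ n (i : cell (univ : Set W) n), f (σ c) ∈ openCell n i → c = ⟨n, i⟩ := by
    intro c hc n i h
    exact eq_of_not_disjoint_openCell (not_disjoint_iff.2 ⟨_, hσ c hc, h⟩)
  have hinj : InjOn (fun c => f (σ c)) 𝒞 := fun c hc d hd hcd =>
    heq c hc d.1 d.2 (by have := hσ d hd; simp only at hcd; rwa [hcd])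
  have hcl : ∀ B ⊆ 𝒞, IsClosed ((fun c => f (σ c)) '' B) := by
    refine fun B hB => isClosed_of_subsingleton_inter_openCell fun n i => ?_
    rintro _ ⟨⟨c, hc, rfl⟩, hci⟩ _ ⟨⟨d, hd, rfl⟩, hdi⟩
    simp only
    rw [heq c (hB hc) n i hci, heq d (hB hd) n i hdi]
  refine countable_of_injective_of_countable_image (f := σ) (fun c hc d hd h =>
    hinj hc hd (congrArg f h)) (hS.countable_of_forall_not_accPt fun s hs => ?_)
  rw [accPt_iff_nhds] at hs
  -- Near `s`, every chosen point `σ c` satisfies `f (σ c) = f s`. Injectivity allows only one such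
  -- `c`, while accumulation in a `T1` space yields two.
  have hU := ((hcl (𝒞 \ {c | f (σ c) = f s}) sdiff_subset).preimage hf).isOpen_compl.mem_nhds
    (x := s) (by rintro ⟨c, hc, hcs⟩; exact hc.2 hcs)
  obtain ⟨_, ⟨hxU, c, hc, rfl⟩, hne⟩ := hs _ hU
  obtain ⟨_, ⟨⟨hxU', hxc⟩, d, hd, rfl⟩, hne'⟩ := hs _
    (Filter.inter_mem hU (isOpen_compl_singleton.mem_nhds hne.symm))
  have key : ∀ e ∈ 𝒞, σ e ∈ (f ⁻¹' ((fun c => f (σ c)) '' (𝒞 \ {c | f (σ c) = f s})))ᶜ →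
      f (σ e) = f s := by
    intro e he h
    by_contra hcon
    exact h ⟨e, ⟨he, hcon⟩, rfl⟩
  exact hxc (congrArg σ (hinj hd hc ((key d hd hxU').trans (key c hc hxU).symm)))

theorem hasCountableClosedNetwork_range [T2Space W] [CWComplex (univ : Set W)] {S : Type v}
    [TopologicalSpace S] [T1Space S] (hS : Omega1Compact S) {f : S → W} (hf : Continuous f) :
    HasCountableClosedNetwork (range f) := by
  have := (countable_openCell_of_omega1Compact hS hf).to_subtype
  refine (HasCountableClosedNetwork.iUnion fun c : {c : Σ n, cell (univ : Set W) n |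
    ∃ s, f s ∈ openCell c.1 c.2} => hasCountableClosedNetwork_closedCell c.1.1 c.1.2).mono ?_
  rintro _ ⟨s, rfl⟩
  have hs : f s ∈ ⋃ (n : ℕ) (j : cell (univ : Set W) n), openCell n j := by
    rw [iUnion_openCell_eq_complex]
    trivial
  simp only [mem_iUnion] at hs
  obtain ⟨n, i, hi⟩ := hs
  exact mem_iUnion.2 ⟨⟨⟨n, i⟩, s, hi⟩, openCell_subset_closedCell n i hi⟩

end Topology.CWComplex

/-! ### Maps and homotopies constant on cones -/

namespace OrderTree

open Ordinal

variable {T : Type u} [PartialOrder T] [OrderTree T] [TopologicalSpace T] [IntervalTopology T]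

/-- Take `y` high enough to decide, for each disjoint pair of network members, whether some higher
cone misses one of them. Two distinct values above `y` would be separated by such a pair, yet the
preimages are disjoint closed sets, so a higher cone, and therefore that of `y`, misses one. -/
theorem IsOmega1Tree.exists_cone_const (hT : IsOmega1Tree T) {S : Set T}
    (hS : Omega1Compact S) {x : T} (hx : x ∈ stem S) {X : Type v} [TopologicalSpace X] [T2Space X]
    {f : S → X} (hf : Continuous f) (hX : HasCountableClosedNetwork (f '' {s | x < (s : T)})) :
    ∃ y ∈ stem S, x ≤ y ∧ ∀ s s' : S, y < s → y < s' → f s = f s' := by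
  have hS' := hasCountableAntichains_of_omega1Compact hS
  obtain ⟨𝓕, h𝓕, hcl, hnet⟩ := hX
  have := h𝓕.to_subtype
  obtain ⟨α, hα, hdec⟩ := hS'.exists_height_decides hT.height_eq
    (ι := {p : 𝓕 × 𝓕 // Disjoint p.1.1 p.2.1})
    (D := fun p => {y | (∀ s : S, y < s → f s ∉ p.1.1.1) ∨
      ∀ s : S, y < s → f s ∉ p.1.2.1}) fun p y hy z _ hyz =>
        hy.imp (fun h s hs => h s (hyz.trans_lt hs)) (fun h s hs => h s (hyz.trans_lt hs))
  obtain ⟨y, -, hy, hxy, hαy⟩ := hT.exists_gt_of_mem_stem hS' hx hα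
  refine ⟨y, hy, hxy.le, fun s s' hs hs' => ?_⟩
  by_contra hne
  obtain ⟨U, V, hU, hV, hsU, hsV, hUV⟩ := t2_separation hne
  obtain ⟨F, hF, hsF, hFU⟩ := hnet (f s) ⟨s, hxy.trans hs, rfl⟩ U (hU.mem_nhds hsU)
  obtain ⟨G, hG, hsG, hGV⟩ := hnet (f s') ⟨s', hxy.trans hs', rfl⟩ V (hV.mem_nhds hsV)
  have hFG : Disjoint F G := hUV.mono hFU hGV
  obtain ⟨z, hz, hyz, b, hb⟩ := hT.exists_cone_disjoint hS hy
    (C := fun b : Bool => f ⁻¹' (bif b then F else G))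
    (fun b => by cases b; exacts [(hcl G hG).preimage hf, (hcl F hF).preimage hf])
    (fun t _ => by
      by_cases h : f t ∈ F
      · exact ⟨false, disjoint_left.1 hFG h⟩
      · exact ⟨true, h⟩)
  have := hdec ⟨(⟨F, hF⟩, ⟨G, hG⟩), hFG⟩ y hy hαy z hz hyz (by
    cases b
    · exact Or.inr hb
    · exact Or.inl hb)
  rcases this with h | h
  · exact h s hs hsF
  · exact h s' hs' hsG

/-- If a homotopy from an `ω₁`-compact subset of an `ω₁`-tree to a space which is locally small
ends with a map that is constant on some cone, then it starts with such a map. -/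
theorem IsOmega1Tree.exists_cone_const_of_homotopy (hT : IsOmega1Tree T) {S : Set T}
    (hS : Omega1Compact S) {x : T} (hx : x ∈ stem S) {X : Type v} [TopologicalSpace X] [T2Space X]
    (hX : ∀ p : X, ∃ U ∈ 𝓝 p, HasCountableClosedNetwork U)
    {h : unitInterval × S → X} (hh : Continuous h)
    {t₁ : unitInterval} (h₁ : ∀ s s' : S, x < s → x < s' → h (t₁, s) = h (t₁, s'))
    (t : unitInterval) :
    ∃ y ∈ stem S, x ≤ y ∧ ∀ s s' : S, y < s → y < s' → h (t, s) = h (t, s') := by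
  have hS' := hasCountableAntichains_of_omega1Compact hS
  let G : T → Set unitInterval := fun y => {t | ∀ s s' : S, y < s → y < s' → h (t, s) = h (t, s')}
  have hGmono : ∀ {y z : T}, y ≤ z → G y ⊆ G z := fun hyz t ht s s' hs hs' =>
    ht s s' (hyz.trans_lt hs) (hyz.trans_lt hs')
  have hGcl : ∀ y, IsClosed (G y) := by
    intro y
    simp only [G, ofPred_forall]
    exact isClosed_iInter fun s => isClosed_iInter fun s' => isClosed_iInter fun _ =>
      isClosed_iInter fun _ => isClosed_eq (by fun_prop) (by fun_prop)
  have hB := TopologicalSpace.isBasis_countableBasis unitInterval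
  have := (TopologicalSpace.countable_countableBasis unitInterval).to_subtype
  -- The sets `G y` grow with `y`; testing them against a countable base makes them constant along
  -- the stem above some `y`.
  obtain ⟨α, hα, hdec⟩ := hS'.exists_height_decides hT.height_eq
    (ι := TopologicalSpace.countableBasis unitInterval)
    (D := fun b => {y | (G y ∩ b).Nonempty}) fun b y hy z _ hyz =>
      hy.mono (inter_subset_inter_left _ (hGmono hyz))
  obtain ⟨y, -, hy, hxy, hαy⟩ := hT.exists_gt_of_mem_stem hS' hx hα
  have hGstable : ∀ z ∈ stem S, y ≤ z → G z ⊆ G y := by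
    intro z hz hyz r hr
    by_contra hry
    obtain ⟨b, hb, hrb, hby⟩ := hB.exists_subset_of_mem_open hry (hGcl y).isOpen_compl
    obtain ⟨q, hqy, hqb⟩ := hdec ⟨b, hb⟩ y hy hαy z hz hyz ⟨r, hr, hrb⟩
    exact hby hqb hqy
  have hGopen : IsOpen (G y) := by
    rw [isOpen_iff_mem_nhds]
    intro r hr
    obtain ⟨s₀, hs₀, hys₀⟩ := OrderTree.exists_gt_of_mem_stem hy
    obtain ⟨U, hU, hUnet⟩ := hX (h (r, ⟨s₀, hs₀⟩))
    obtain ⟨K, hK⟩ := (𝓝 r).exists_antitone_basis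
    -- These are the points carried out of `interior U` at some time in `closure (K n)`; projecting
    -- along the compact interval keeps the set closed. No point above `y` lies in all of them.
    have hclosed : ∀ n, IsClosed (Prod.snd '' ((closure (K n) ×ˢ Set.univ) ∩
        h ⁻¹' (interior U)ᶜ)) := fun n =>
      isClosedMap_snd_of_compactSpace _ ((isClosed_closure.prod isClosed_univ).inter
        (isOpen_interior.isClosed_compl.preimage hh))
    obtain ⟨z, hz, hyz, n, hn⟩ := hT.exists_cone_disjoint hS hy hclosed fun s hs => by
      have hmem : h (r, s) ∈ interior U := by
        rw [hr s ⟨s₀, hs₀⟩ hs hys₀]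
        exact mem_interior_iff_mem_nhds.2 hU
      have hnhds : (fun q => h (q, s)) ⁻¹' interior U ∈ 𝓝 r :=
        (isOpen_interior.preimage (by fun_prop)).mem_nhds hmem
      obtain ⟨n, -, hn⟩ := hK.1.nhds_closure.mem_iff.1 hnhds
      refine ⟨n, ?_⟩
      rintro ⟨⟨q, s'⟩, ⟨⟨hq, -⟩, hqs⟩, rfl⟩
      exact hqs (hn hq)
    refine Filter.mem_of_superset (hK.1.mem_of_mem (i := n) trivial) fun q hq => ?_
    have hsub : (fun s => h (q, s)) '' {s : S | z < s} ⊆ U := by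
      rintro _ ⟨s, hs, rfl⟩
      by_contra hcon
      exact hn s hs ⟨(q, s), ⟨⟨subset_closure hq, trivial⟩,
        fun h' => hcon (interior_subset h')⟩, rfl⟩
    obtain ⟨z', hz', hzz', hconst⟩ := hT.exists_cone_const hS hz
      (f := fun s => h (q, s)) (by fun_prop) (hUnet.mono hsub)
    exact hGstable z' hz' (hyz.trans hzz') hconst
  have huniv : G y = Set.univ := IsClopen.eq_univ ⟨hGcl y, hGopen⟩ ⟨t₁, hGmono hxy.le h₁⟩
  exact ⟨y, hy, hxy.le, (huniv.symm ▸ mem_univ t : t ∈ G y)⟩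

theorem IsOmega1Tree.not_isHeCWc_of_isEmbedding {M : Type v} [TopologicalSpace M]
    (hM : IsManifoldWithBoundary M) (hT : IsOmega1Tree T) {S : Set T} (hSc : ¬ S.Countable)
    (hS : Omega1Compact S) {e : S → M} (he : IsEmbedding e) : ¬ IsHeCWc.{v, w} M := by
  rintro ⟨W, _, _, ⟨_⟩, ⟨E⟩⟩
  have := hM.t2
  have : T2Space S := he.t2Space
  have hS' := hasCountableAntichains_of_omega1Compact hS
  obtain ⟨x, hx⟩ : (stem S).Nonempty := by
    by_contra h
    rw [not_nonempty_iff_eq_empty] at h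
    exact hSc (by simpa [h] using hS'.countable_diff_stem)
  obtain ⟨H⟩ := E.left_inv
  have hcont : Continuous fun s => E.toFun (e s) := E.toFun.continuous.comp he.continuous
  obtain ⟨y, hy, -, hconst⟩ := hT.exists_cone_const hS hx hcont
    ((CWComplex.hasCountableClosedNetwork_range hS hcont).mono (image_subset_range _ _))
  -- `H` runs from `E.invFun ∘ E.toFun` at time `0` to the identity at time `1`.
  obtain ⟨z, hz, -, hzconst⟩ := hT.exists_cone_const_of_homotopy hS hy
    hM.exists_nhds_hasCountableClosedNetwork
    (h := fun p => H (p.1, e p.2)) (t₁ := 0)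
    (H.continuous.comp (continuous_fst.prodMk (he.continuous.comp continuous_snd)))
    (fun s s' hs hs' => by
      simp only [ContinuousMap.Homotopy.apply_zero, ContinuousMap.comp_apply]
      exact congrArg E.invFun (hconst s s' hs hs')) 1
  refine hz (Set.Subsingleton.countable fun s hs s' hs' => ?_)
  have := hzconst ⟨s, hs.1⟩ ⟨s', hs'.1⟩ hs.2 hs'.2
  simp only [ContinuousMap.Homotopy.apply_one, ContinuousMap.id_apply] at this
  exact congrArg Subtype.val (he.injective this)

/-! ### Suslin trees -/

theorem IsSuslin.isOmega1Tree {T : Type u} [PartialOrder T] [OrderTree T] (hT : IsSuslin T) :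
    IsOmega1Tree T where
  hausdorff := hT.hausdorff
  height_eq := hT.height_eq
  countable_level _ := hT.countable_antichain _ fun _ ha _ hb hne hab =>
    (height_strictMono (lt_of_le_of_ne hab hne)).ne (ha.trans hb.symm)

theorem not_countable_univ {T : Type u} [PartialOrder T] [OrderTree T] (hT : treeHeight T = ω₁) :
    ¬ (univ : Set T).Countable := by
  intro h
  obtain ⟨α, hα, hαT⟩ := exists_height_lt hT h
  refine hα.not_ge ?_
  rw [← hT]
  exact Ordinal.iSup_le fun x => Order.succ_le_of_lt (hαT x (mem_univ x))

/-- At a minimal `y` with infinitely many points of `A` below it, only finitely many lie below any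
`w < y`, so `A` accumulates at `y`. -/
theorem exists_accPt_of_infinite {A : Set T} {z : T} (h : (A ∩ Iio z).Infinite) :
    ∃ x, AccPt x (Filter.principal A) := by
  obtain ⟨y, hyz, hy⟩ := exists_minimal_le (D := {y | (A ∩ Iio y).Infinite}) h
  refine ⟨y, accPt_iff_nhds.2 fun U hU => ?_⟩
  obtain ⟨V, hVU, hV, hyV⟩ := mem_nhds_iff.1 hU
  obtain ⟨a, ha⟩ := hy.1.nonempty
  obtain ⟨w, hw, hwV⟩ := exists_Ioc_subset hV hyV (not_isMin_iff.2 ⟨a, ha.2⟩)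
  have hfin : (A ∩ Iic w).Finite := by
    refine Finite.subset (s := (A ∩ Iio w) ∪ {w}) (Finite.union ?_ (finite_singleton w)) ?_
    · by_contra hinf
      exact hw.not_ge (hy.2 hinf hw.le)
    · rintro b ⟨hb, hbw⟩
      rcases (mem_Iic.1 hbw).lt_or_eq with h | h
      · exact Or.inl ⟨hb, h⟩
      · exact Or.inr h
  obtain ⟨b, ⟨hbA, hby⟩, hbw⟩ := (hy.1.sdiff hfin).nonempty
  refine ⟨b, ⟨hVU (hwV ⟨?_, (mem_Iio.1 hby).le⟩), hbA⟩, (mem_Iio.1 hby).ne⟩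
  rcases lt_or_le_of_le hw.le (mem_Iio.1 hby).le with h | h
  · exact h
  · exact (hbw ⟨hbA, h⟩).elim

/-- Each point has finitely many points of a closed discrete `A` below it. Those members of `A` with
exactly `n` predecessors in `A` form an antichain. -/
theorem IsSuslin.omega1Compact (hT : IsSuslin T) : Omega1Compact T := by
  intro A hA hAd
  have hfin : ∀ z, (A ∩ Iio z).Finite := fun z => by
    by_contra h
    obtain ⟨x, hx⟩ := exists_accPt_of_infinite h
    have hxA := isClosed_iff_accPt.1 hA x hx
    obtain ⟨U, hU, hUA⟩ := discreteTopology_subtype_iff'.1 hAd x hxA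
    obtain ⟨b, hb, hbx⟩ := accPt_iff_nhds.1 hx U
      (hU.mem_nhds (hUA.superset rfl).1)
    exact hbx (hUA.subset hb)
  have hcover : A ⊆ ⋃ n : ℕ, {a ∈ A | (A ∩ Iio a).ncard = n} := fun a ha =>
    mem_iUnion.2 ⟨_, ha, rfl⟩
  refine (countable_iUnion fun n => hT.countable_antichain _ ?_).mono hcover
  rintro a ⟨ha, han⟩ b ⟨hb, hbn⟩ hne hab
  refine (ncard_lt_ncard (?_ : A ∩ Iio a ⊂ A ∩ Iio b) (hfin b)).ne (han.trans hbn.symm)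
  have hlt := lt_of_le_of_ne hab hne
  exact ⟨inter_subset_inter_right _ (Iio_subset_Iio hab), fun h => (h ⟨ha, hlt⟩).2.ne rfl⟩

end OrderTree

theorem theorem1p4 {M : Type u} [TopologicalSpace M] (hM : IsManifoldWithBoundary M) :
    (∀ (T : Type w) [PartialOrder T] [OrderTree T] [TopologicalSpace T]
        [OrderTree.IntervalTopology T], OrderTree.IsOmega1Tree T →
      ∀ S : Set T, ¬ S.Countable → Omega1Compact S →
        (∃ e : S → M, IsEmbedding e) → ¬ IsHeCWc.{u, v} M) ∧
    (∀ (T : Type w) [PartialOrder T] [OrderTree T] [TopologicalSpace T]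
        [OrderTree.IntervalTopology T], OrderTree.IsSuslin T →
        (∃ e : T → M, IsEmbedding e) → ¬ IsHeCWc.{u, v} M) := by
  refine ⟨fun T _ _ _ _ hT S hSc hS ⟨e, he⟩ => hT.not_isHeCWc_of_isEmbedding hM hSc hS he,
    fun T _ _ _ _ hT ⟨e, he⟩ => ?_⟩
  exact hT.isOmega1Tree.not_isHeCWc_of_isEmbedding hM (OrderTree.not_countable_univ hT.height_eq)
    hT.omega1Compact.univ (he.comp .subtypeVal)
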